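/- Let $n$ be a nonnegative integer, $[n]=\{1,\dots,n\}$, and let $f:2^{[n]}\to\mathbb Z$ satisfy $f(\emptyset)=0$ and $f(I)+f(J)\ge f(I\cup J)+f(I\cap J)$ for all $I,J\subseteq[n]$. The polymatroid over $[n]$ with rank function $f$ is the (finite) set of its bases $$P=\Big\{\mathbf a\in\mathbb Z^n : \sum_{i\in I}a_i\le f(I)\text{ for all } I\subseteq[n],\ \sum_{i\in[n]}a_i=f([n])\Big\}.$$ Let $\mathbf e_1,\dots,\mathbf e_n$ be the standard basis of $\mathbb Z^n$. For $\mathbf a\in P$, let $\mathrm{Int}(\mathbf a)$ be the set of $i\in[n]$ such that $\mathbf a-\mathbf e_i+\mathbf e_j\notin P$ for all $j<i$, and let $\mathrm{Ext}(\mathbf a)$ be the set of $i\in[n]$ such that $\mathbf a+\mathbf e_i-\mathbf e_j\notin P$ for all $j<i$. The polymatroid Tutte polynomial of $P$ is $$\mathscr T_P(x,y)=\sum_{\mathbf a\in P}x^{|\mathrm{Int}(\mathbf a)\setminus\mathrm{Ext}(\mathbf a)|}\,y^{|\mathrm{Ext}(\mathbf a)\setminus\mathrm{Int}(\mathbf a)|}\,(x+y-1)^{|\mathrm{Int}(\mathbf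 a)\cap\mathrm{Ext}(\mathbf a)|}.$$ **Theorem.** For every $k\in[n]$, the coefficient of $x^{n-k}y^{k-1}$ in $\mathscr T_P(x,y)$ equals $$\sum_{\substack{S\subseteq[n]\\ |S|=k-1}}f(S)+\sum_{\substack{S'\subseteq[n]\\ |S'|=k}}f(S')-\binom{n}{k-1}f([n])-k\binom{n}{k}.$$ -/

import Mathlib

open Finset

/-- A polymatroid over the ground set `[n]` (modelled by `Fin n` with its natural order), given by
its rank function: an integer-valued submodular set function vanishing on the empty set. It need
be neither monotone nor nonnegative. -/
structure Polymatroid (n : ℕ) where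
  rank : Finset (Fin n) → ℤ
  rank_empty : rank ∅ = 0
  submodular : ∀ I J : Finset (Fin n), rank (I ∪ J) + rank (I ∩ J) ≤ rank I + rank J

namespace Polymatroid

variable {n : ℕ}

/-- The set of (integer) bases of the polymatroid. -/
def bases (P : Polymatroid n) : Set (Fin n → ℤ) :=
  {a | (∀ I : Finset (Fin n), ∑ i ∈ I, a i ≤ P.rank I) ∧ ∑ i, a i = P.rank univ}

theorem finite_bases (P : Polymatroid n) : P.bases.Finite := by
  refine (Set.finite_Icc (fun i => P.rank univ - P.rank (univ.erase i))
    (fun i => P.rank {i})).subset ?_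
  rintro a ⟨h1, h2⟩
  refine ⟨fun i => ?_, fun i => ?_⟩
  · have h3 := Finset.add_sum_erase univ a (mem_univ i)
    have h4 := h1 (univ.erase i)
    simp only
    linarith
  · simpa using h1 {i}

open Classical in
/-- The internally active indices of `a`: those `i` with `a - e_i + e_j` not a basis for
every `j < i`. -/
noncomputable def internallyActive (P : Polymatroid n) (a : Fin n → ℤ) : Finset (Fin n) :=
  {i | ∀ j < i, a - Pi.single i 1 + Pi.single j 1 ∉ P.bases}

open Classical in
/-- The externally active indices of `a`: those `i` with `a + e_i - e_j` not a basis for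
every `j < i`. -/
noncomputable def externallyActive (P : Polymatroid n) (a : Fin n → ℤ) : Finset (Fin n) :=
  {i | ∀ j < i, a + Pi.single i 1 - Pi.single j 1 ∉ P.bases}

/-- The polymatroid Tutte polynomial, in the variables `x = X 0` and `y = X 1`. -/
noncomputable def tutte (P : Polymatroid n) : MvPolynomial (Fin 2) ℤ :=
  ∑ a ∈ P.finite_bases.toFinset,
    MvPolynomial.X 0 ^ #(P.internallyActive a \ P.externallyActive a) *
      MvPolynomial.X 1 ^ #(P.externallyActive a \ P.internallyActive a) *
      (MvPolynomial.X 0 + MvPolynomial.X 1 - 1) ^ #(P.internallyActive a ∩ P.externallyActive a)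

end Polymatroid

/-! Induct on the ground set by fixing the last coordinate `j`, which runs from `minLast` to
`maxLast`. Activity of the other indices is decided inside the slice. The last index is internally
active exactly in the lowest slice and externally active exactly in the highest, so
`tutte_eq_sum_slice` gives `T_P = ∑ T_j + (x - 1) T_min + (y - 1) T_max`.

Hence the total degree is at most `n`, and Pascal's rule makes the degree-`n` coefficients binomials
independent of `P` (`coeff_tutte_top`). One degree lower, intermediate slices enter only through
these binomials, so only their number `maxLast - minLast + 1` matters. Ranks otherwise enter through
the two extreme slices, whose rank functions are explicit. -/

namespace Polymatroid

variable {n : ℕ}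

open MvPolynomial

/-! ### Subsets of `[n + 1]` with and without the last element. -/

section Finset

theorem sum_snoc_map_castSucc (b : Fin n → ℤ) (j : ℤ) (I : Finset (Fin n)) :
    ∑ i ∈ I.map Fin.castSuccEmb, (Fin.snoc b j : Fin (n + 1) → ℤ) i = ∑ i ∈ I, b i := by
  simp [Finset.sum_map]

theorem last_notMem_map_castSucc (I : Finset (Fin n)) :
    Fin.last n ∉ I.map Fin.castSuccEmb := by
  simp [Fin.castSucc_ne_last]

theorem sum_snoc_insert_last (b : Fin n → ℤ) (j : ℤ) (I : Finset (Fin n)) :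
    ∑ i ∈ insert (Fin.last n) (I.map Fin.castSuccEmb), (Fin.snoc b j : Fin (n + 1) → ℤ) i =
      ∑ i ∈ I, b i + j := by
  rw [Finset.sum_insert (last_notMem_map_castSucc I), sum_snoc_map_castSucc, Fin.snoc_last, add_comm]

theorem insert_last_map_univ :
    insert (Fin.last n) ((univ : Finset (Fin n)).map Fin.castSuccEmb) = univ := by
  ext i
  induction i using Fin.lastCases <;> simp

theorem finset_fin_succ_cases (I : Finset (Fin (n + 1))) :
    ∃ J : Finset (Fin n), I = J.map Fin.castSuccEmb ∨
      I = insert (Fin.last n) (J.map Fin.castSuccEmb) := by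
  refine ⟨univ.filter fun i => i.castSucc ∈ I, ?_⟩
  by_cases h : Fin.last n ∈ I
  · right
    ext i
    induction i using Fin.lastCases <;> simp [h, Fin.castSucc_ne_last]
  · left
    ext i
    induction i using Fin.lastCases <;> simp [h, Fin.castSucc_ne_last]

theorem sum_powersetCard_succ (g : Finset (Fin (n + 1)) → ℤ) (b : ℕ) :
    ∑ S ∈ powersetCard (b + 1) univ, g S =
      ∑ S ∈ powersetCard (b + 1) univ, g (S.map Fin.castSuccEmb) +
        ∑ S ∈ powersetCard b univ, g (insert (Fin.last n) (S.map Fin.castSuccEmb)) := by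
  rw [← insert_last_map_univ, powersetCard_succ_insert (last_notMem_map_castSucc _),
    Finset.sum_union, Finset.sum_image, powersetCard_map, powersetCard_map, Finset.sum_map,
    Finset.sum_map]
  · rfl
  · intro S hS T hT hST
    have hS' : Fin.last n ∉ S := fun h =>
      last_notMem_map_castSucc univ ((mem_powersetCard.1 hS).1 h)
    have hT' : Fin.last n ∉ T := fun h =>
      last_notMem_map_castSucc univ ((mem_powersetCard.1 hT).1 h)
    rw [← erase_insert hS', ← erase_insert hT']
    exact congrArg (fun U => U.erase (Fin.last n)) hST
  · rw [Finset.disjoint_left]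
    rintro S hS hS'
    obtain ⟨T, -, rfl⟩ := mem_image.1 hS'
    exact last_notMem_map_castSucc univ ((mem_powersetCard.1 hS).1 (mem_insert_self _ _))

end Finset

/-! ### Tight sets and basis exchanges. -/

section Tight

variable (P : Polymatroid n)

/-- The sets on which the rank inequality is an equality at `a`. -/
def IsTight (a : Fin n → ℤ) (I : Finset (Fin n)) : Prop := ∑ i ∈ I, a i = P.rank I

variable {P} {a : Fin n → ℤ}

/-- Coordinate sums are modular and the rank is submodular, so the slacks at the union and the
intersection are nonnegative with sum at most zero. -/
theorem IsTight.union_inter (ha : a ∈ P.bases) {I J : Finset (Fin n)} (hI : P.IsTight a I)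
    (hJ : P.IsTight a J) : P.IsTight a (I ∪ J) ∧ P.IsTight a (I ∩ J) := by
  have h1 := ha.1 (I ∪ J)
  have h2 := ha.1 (I ∩ J)
  have h3 := P.submodular I J
  have h4 := Finset.sum_union_inter (s₁ := I) (s₂ := J) (f := a)
  unfold IsTight at *
  constructor <;> linarith

theorem sum_exchange (a : Fin n → ℤ) (i j : Fin n) (I : Finset (Fin n)) :
    ∑ l ∈ I, (a - Pi.single i 1 + Pi.single j 1 : Fin n → ℤ) l =
      ∑ l ∈ I, a l - (if i ∈ I then 1 else 0) + (if j ∈ I then 1 else 0) := by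
  simp [Finset.sum_add_distrib, Finset.sum_sub_distrib, Finset.sum_pi_single']

/-- The exchange raises, by one, only the sums over sets containing `j` but not `i`; by integrality
a violated inequality was tight before. -/
theorem exists_isTight_of_exchange_notMem (ha : a ∈ P.bases) {i j : Fin n}
    (h : a - Pi.single i 1 + Pi.single j 1 ∉ P.bases) :
    ∃ I, P.IsTight a I ∧ j ∈ I ∧ i ∉ I := by
  by_contra hcon
  push Not at hcon
  refine h ⟨fun I => ?_, ?_⟩
  · rw [sum_exchange]
    have h1 := ha.1 I
    have h2 := hcon I
    unfold IsTight at h2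
    split_ifs with h3 h4 h4
    · linarith
    · linarith
    · have : ∑ i ∈ I, a i ≠ P.rank I := fun h5 => h3 (h2 h5 h4)
      omega
    · linarith
  · rw [sum_exchange]
    simpa using ha.2

theorem mem_internallyActive {i : Fin n} : i ∈ P.internallyActive a ↔
    ∀ j < i, a - Pi.single i 1 + Pi.single j 1 ∉ P.bases := by
  simp [internallyActive]

theorem mem_externallyActive {i : Fin n} : i ∈ P.externallyActive a ↔
    ∀ j < i, a - Pi.single j 1 + Pi.single i 1 ∉ P.bases := by
  simp only [externallyActive, mem_filter, mem_univ, true_and, add_sub_right_comm]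

end Tight

/-! ### Slices by the last coordinate, and activity of the last index. -/

section Slice

/-- The least value of the last coordinate on the bases. -/
def minLast (P : Polymatroid (n + 1)) : ℤ :=
  P.rank univ - P.rank (univ.map Fin.castSuccEmb)

/-- The greatest value of the last coordinate on the bases. -/
def maxLast (P : Polymatroid (n + 1)) : ℤ := P.rank {Fin.last n}

variable (P : Polymatroid (n + 1))

theorem minLast_le_maxLast : P.minLast ≤ P.maxLast := by
  have h := P.submodular {Fin.last n} (univ.map Fin.castSuccEmb)
  rw [singleton_union, insert_last_map_univ,
    singleton_inter_of_notMem (last_notMem_map_castSucc _), P.rank_empty] at h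
  unfold minLast maxLast
  linarith

/-- The polymatroid of bases whose last coordinate is `j`. -/
def slice (j : ℤ) (hj : j ≤ P.maxLast) : Polymatroid n where
  rank I := min (P.rank (I.map Fin.castSuccEmb))
    (P.rank (insert (Fin.last n) (I.map Fin.castSuccEmb)) - j)
  rank_empty := by
    unfold maxLast at hj
    simp [P.rank_empty, hj]
  submodular I J := by
    have hI := last_notMem_map_castSucc I
    have hJ := last_notMem_map_castSucc J
    rw [map_union, map_inter]
    generalize I.map Fin.castSuccEmb = I at *
    generalize J.map Fin.castSuccEmb = J at *
    -- One inequality for each choice of the terms attaining the two minima.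
    have h1 := P.submodular I J
    have h2 := P.submodular (insert (Fin.last n) I) (insert (Fin.last n) J)
    have h3 := P.submodular (insert (Fin.last n) I) J
    have h4 := P.submodular I (insert (Fin.last n) J)
    rw [← insert_union_distrib, ← insert_inter_distrib] at h2
    rw [insert_union, insert_inter_of_notMem hJ] at h3
    rw [union_insert, inter_insert_of_notMem hI] at h4
    omega

theorem slice_rank (j : ℤ) (hj : j ≤ P.maxLast) (I : Finset (Fin n)) :
    (P.slice j hj).rank I = min (P.rank (I.map Fin.castSuccEmb))
      (P.rank (insert (Fin.last n) (I.map Fin.castSuccEmb)) - j) := rfl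

theorem slice_minLast_rank (I : Finset (Fin n)) :
    (P.slice P.minLast P.minLast_le_maxLast).rank I = P.rank (I.map Fin.castSuccEmb) := by
  rw [slice_rank, min_eq_left]
  have h := P.submodular (insert (Fin.last n) (I.map Fin.castSuccEmb)) (univ.map Fin.castSuccEmb)
  rw [insert_union, insert_inter_of_notMem (last_notMem_map_castSucc _), ← map_union, ← map_inter,
    union_eq_right.2 (subset_univ I), inter_univ, insert_last_map_univ] at h
  unfold minLast
  linarith

theorem slice_maxLast_rank (I : Finset (Fin n)) :
    (P.slice P.maxLast le_rfl).rank I =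
      P.rank (insert (Fin.last n) (I.map Fin.castSuccEmb)) - P.maxLast := by
  rw [slice_rank, min_eq_right]
  have h := P.submodular {Fin.last n} (I.map Fin.castSuccEmb)
  rw [singleton_union, singleton_inter_of_notMem (last_notMem_map_castSucc _), P.rank_empty] at h
  unfold maxLast
  linarith

theorem last_mem_Icc {a : Fin (n + 1) → ℤ} (ha : a ∈ P.bases) :
    a (Fin.last n) ∈ Icc P.minLast P.maxLast := by
  have h1 := ha.1 {Fin.last n}
  have h2 := ha.1 (univ.map Fin.castSuccEmb)
  have h3 := ha.2
  rw [← insert_last_map_univ, sum_insert (last_notMem_map_castSucc _), insert_last_map_univ] at h3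
  rw [sum_singleton] at h1
  rw [mem_Icc, minLast, maxLast]
  constructor <;> linarith

variable {P}

theorem mem_slice_bases {j : ℤ} (hj : j ∈ Icc P.minLast P.maxLast) (b : Fin n → ℤ) :
    b ∈ (P.slice j (mem_Icc.1 hj).2).bases ↔ (Fin.snoc b j : Fin (n + 1) → ℤ) ∈ P.bases := by
  -- The lower bound on `j` ensures that slice bases have the right total.
  have huniv : (P.slice j (mem_Icc.1 hj).2).rank univ = P.rank univ - j := by
    have := (mem_Icc.1 hj).1
    rw [slice_rank, insert_last_map_univ, min_eq_right]
    unfold minLast at this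
    linarith
  unfold bases
  simp only [Set.mem_ofPred_eq, huniv, slice_rank, le_min_iff]
  have hs := sum_snoc_insert_last b j univ
  rw [insert_last_map_univ] at hs
  rw [hs]
  refine and_congr ⟨fun h I => ?_, fun h I => ⟨?_, ?_⟩⟩ ⟨fun h => ?_, fun h => ?_⟩
  · obtain ⟨J, rfl | rfl⟩ := finset_fin_succ_cases I
    · rw [sum_snoc_map_castSucc]; exact (h J).1
    · rw [sum_snoc_insert_last]; linarith [(h J).2]
  · rw [← sum_snoc_map_castSucc b j]; exact h _
  · have := h (insert (Fin.last n) (I.map Fin.castSuccEmb))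
    rw [sum_snoc_insert_last] at this
    linarith
  · linarith
  · linarith

theorem snoc_exchange (b : Fin n → ℤ) (j : ℤ) (i l : Fin n) :
    (Fin.snoc b j - Pi.single i.castSucc 1 + Pi.single l.castSucc 1 : Fin (n + 1) → ℤ) =
      Fin.snoc (b - Pi.single i 1 + Pi.single l 1 : Fin n → ℤ) j := by
  funext t
  induction t using Fin.lastCases <;>
    simp [Pi.single_apply, (Fin.castSucc_ne_last _).symm]

theorem castSucc_mem_internallyActive {j : ℤ} (hj : j ∈ Icc P.minLast P.maxLast)
    (b : Fin n → ℤ) (i : Fin n) :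
    i.castSucc ∈ P.internallyActive (Fin.snoc b j) ↔
      i ∈ (P.slice j (mem_Icc.1 hj).2).internallyActive b := by
  rw [mem_internallyActive, mem_internallyActive, Fin.forall_fin_succ']
  simp only [Fin.castSucc_lt_castSucc_iff, snoc_exchange, mem_slice_bases hj,
    (Fin.le_last _).not_gt, false_imp_iff, and_true]

theorem castSucc_mem_externallyActive {j : ℤ} (hj : j ∈ Icc P.minLast P.maxLast)
    (b : Fin n → ℤ) (i : Fin n) :
    i.castSucc ∈ P.externallyActive (Fin.snoc b j) ↔
      i ∈ (P.slice j (mem_Icc.1 hj).2).externallyActive b := by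
  rw [mem_externallyActive, mem_externallyActive, Fin.forall_fin_succ']
  simp only [Fin.castSucc_lt_castSucc_iff, snoc_exchange, mem_slice_bases hj,
    (Fin.le_last _).not_gt, false_imp_iff, and_true]

/-- Each blocked exchange yields a tight set containing `j` and missing the last index. Their union
is the complement of the last index, and its tightness says the last coordinate is minimal. -/
theorem last_mem_internallyActive {a : Fin (n + 1) → ℤ} (ha : a ∈ P.bases) :
    Fin.last n ∈ P.internallyActive a ↔ a (Fin.last n) = P.minLast := by
  rw [mem_internallyActive]
  constructor
  · intro h
    choose! T hT using fun j hj => exists_isTight_of_exchange_notMem ha (h j hj)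
    have key : ∀ s : Finset (Fin n), ∃ I, P.IsTight a I ∧ s.map Fin.castSuccEmb ⊆ I ∧
        Fin.last n ∉ I := by
      intro s
      induction s using Finset.induction_on with
      | empty => exact ⟨∅, by simp [IsTight, P.rank_empty]⟩
      | insert i s _ ih =>
        obtain ⟨I, h1, h2, h3⟩ := ih
        obtain ⟨h4, h5, h6⟩ := hT i.castSucc (Fin.castSucc_lt_last i)
        refine ⟨T i.castSucc ∪ I, (h4.union_inter ha h1).1, ?_, by simp [h3, h6]⟩
        rw [map_insert, insert_subset_iff]
        exact ⟨mem_union_left _ h5, h2.trans subset_union_right⟩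
    obtain ⟨I, h1, h2, h3⟩ := key univ
    have hI : I = univ.map Fin.castSuccEmb := by
      refine subset_antisymm (fun i hi => ?_) h2
      induction i using Fin.lastCases with
      | last => exact absurd hi h3
      | cast i => simp
    have h4 := ha.2
    rw [← insert_last_map_univ, sum_insert (last_notMem_map_castSucc _), insert_last_map_univ,
      ← hI, h1] at h4
    rw [minLast, ← hI]
    linarith
  · intro h j hj hb
    have := (mem_Icc.1 (P.last_mem_Icc hb)).1
    simp [h, Pi.single_eq_of_ne hj.ne'] at this

/-- Dually, intersecting the tight sets, starting from the tight set `univ`, leaves only the last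
index. -/
theorem last_mem_externallyActive {a : Fin (n + 1) → ℤ} (ha : a ∈ P.bases) :
    Fin.last n ∈ P.externallyActive a ↔ a (Fin.last n) = P.maxLast := by
  rw [mem_externallyActive]
  constructor
  · intro h
    choose! T hT using fun j hj => exists_isTight_of_exchange_notMem ha (h j hj)
    have key : ∀ s : Finset (Fin n), ∃ I, P.IsTight a I ∧ Disjoint (s.map Fin.castSuccEmb) I ∧
        Fin.last n ∈ I := by
      intro s
      induction s using Finset.induction_on with
      | empty => exact ⟨univ, ha.2, by simp⟩
      | insert i s _ ih =>
        obtain ⟨I, h1, h2, h3⟩ := ih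
        obtain ⟨h4, h5, h6⟩ := hT i.castSucc (Fin.castSucc_lt_last i)
        refine ⟨T i.castSucc ∩ I, (h4.union_inter ha h1).2, ?_, mem_inter.2 ⟨h5, h3⟩⟩
        rw [map_insert, disjoint_insert_left]
        exact ⟨fun h7 => h6 (mem_inter.1 h7).1, h2.mono_right inter_subset_right⟩
    obtain ⟨I, h1, h2, h3⟩ := key univ
    have hI : I = {Fin.last n} := by
      refine subset_antisymm (fun i hi => ?_) (by simpa using h3)
      induction i using Fin.lastCases with
      | last => simp
      | cast i => exact absurd hi (Finset.disjoint_left.1 h2 (by simp))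
    rw [hI, IsTight, sum_singleton] at h1
    exact h1
  · intro h j hj hb
    have := (mem_Icc.1 (P.last_mem_Icc hb)).2
    simp [h, Pi.single_eq_of_ne hj.ne'] at this

end Slice

/-! ### The slice recursion for the Tutte polynomial and its coefficients. -/

section Tutte

open Classical in
-- Since `x + y - 1 = 1 + (x - 1) + (y - 1)`, the weight is a product over indices, from which the
-- last factor can be split off.
theorem tutte_eq_sum_prod (P : Polymatroid n) :
    P.tutte = ∑ a ∈ P.finite_bases.toFinset, ∏ i,
      (1 + (if i ∈ P.internallyActive a then X 0 - 1 else 0) +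
        (if i ∈ P.externallyActive a then X 1 - 1 else 0) : MvPolynomial (Fin 2) ℤ) := by
  unfold tutte
  refine Finset.sum_congr rfl fun a _ => ?_
  generalize P.internallyActive a = A
  generalize P.externallyActive a = B
  have h (s : Finset (Fin n)) (p : MvPolynomial (Fin 2) ℤ) :
      p ^ #s = ∏ i, if i ∈ s then p else 1 := by
    rw [Finset.prod_ite_mem, univ_inter, prod_const]
  rw [h, h, h, ← Finset.prod_mul_distrib, ← Finset.prod_mul_distrib]
  refine Finset.prod_congr rfl fun i _ => ?_
  by_cases hA : i ∈ A <;> by_cases hB : i ∈ B <;> simp [hA, hB]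
  ring

theorem tutte_zero (P : Polymatroid 0) : P.tutte = 1 := by
  have h : P.finite_bases.toFinset = {0} := by
    ext a
    simp only [Set.Finite.mem_toFinset, mem_singleton, Subsingleton.elim a 0, iff_true]
    refine ⟨fun I => ?_, ?_⟩
    · rw [Subsingleton.elim I ∅, P.rank_empty, sum_empty]
    · rw [Subsingleton.elim univ ∅, P.rank_empty, sum_empty]
  rw [tutte_eq_sum_prod, h]
  simp

theorem sum_bases_eq_sum_slice {M : Type*} [AddCommMonoid M] (P : Polymatroid (n + 1))
    (F : (Fin (n + 1) → ℤ) → M) :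
    ∑ a ∈ P.finite_bases.toFinset, F a =
      ∑ j ∈ (Icc P.minLast P.maxLast).attach,
        ∑ b ∈ (P.slice j (mem_Icc.1 j.2).2).finite_bases.toFinset, F (Fin.snoc b j.1) := by
  rw [← Finset.sum_fiberwise_of_maps_to (t := Icc P.minLast P.maxLast)
    (g := fun a => a (Fin.last n)) fun a ha => P.last_mem_Icc (by simpa using ha),
    ← Finset.sum_attach]
  refine Finset.sum_congr rfl fun j _ => ?_
  refine Finset.sum_nbij' (fun a => Fin.init a) (fun b => Fin.snoc b j.1) ?_ ?_ ?_ ?_ ?_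
  · intro a ha
    rw [mem_filter, Set.Finite.mem_toFinset] at ha
    rw [Set.Finite.mem_toFinset, mem_slice_bases j.2, ← ha.2, Fin.snoc_init_self]
    exact ha.1
  · intro b hb
    rw [Set.Finite.mem_toFinset, mem_slice_bases j.2] at hb
    rw [mem_filter, Set.Finite.mem_toFinset]
    exact ⟨hb, Fin.snoc_last _ _⟩
  · intro a ha
    rw [← (mem_filter.1 ha).2, Fin.snoc_init_self]
  · intro b _
    exact Fin.init_snoc _ _
  · intro a ha
    rw [← (mem_filter.1 ha).2, Fin.snoc_init_self]

theorem tutte_eq_sum_slice (P : Polymatroid (n + 1)) :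
    P.tutte = ∑ j ∈ (Icc P.minLast P.maxLast).attach, (P.slice j (mem_Icc.1 j.2).2).tutte +
      (X 0 - 1) * (P.slice P.minLast P.minLast_le_maxLast).tutte +
      (X 1 - 1) * (P.slice P.maxLast le_rfl).tutte := by
  classical
  have key : ∀ j : {j // j ∈ Icc P.minLast P.maxLast},
      ∑ b ∈ (P.slice j (mem_Icc.1 j.2).2).finite_bases.toFinset, ∏ i,
        (1 + (if i ∈ P.internallyActive (Fin.snoc b j.1) then X 0 - 1 else 0) +
          (if i ∈ P.externallyActive (Fin.snoc b j.1) then X 1 - 1 else 0) :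
            MvPolynomial (Fin 2) ℤ) =
      (P.slice j (mem_Icc.1 j.2).2).tutte +
        (if j = ⟨P.minLast, left_mem_Icc.2 P.minLast_le_maxLast⟩ then
          (X 0 - 1) * (P.slice j (mem_Icc.1 j.2).2).tutte else 0) +
        (if j = ⟨P.maxLast, right_mem_Icc.2 P.minLast_le_maxLast⟩ then
          (X 1 - 1) * (P.slice j (mem_Icc.1 j.2).2).tutte else 0) := by
    intro j
    have h : ∀ b ∈ (P.slice j (mem_Icc.1 j.2).2).finite_bases.toFinset, ∏ i,
        (1 + (if i ∈ P.internallyActive (Fin.snoc b j.1) then X 0 - 1 else 0) +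
          (if i ∈ P.externallyActive (Fin.snoc b j.1) then X 1 - 1 else 0) :
            MvPolynomial (Fin 2) ℤ) =
        (∏ i, (1 + (if i ∈ (P.slice j (mem_Icc.1 j.2).2).internallyActive b then X 0 - 1 else 0) +
          (if i ∈ (P.slice j (mem_Icc.1 j.2).2).externallyActive b then X 1 - 1 else 0))) *
          (1 + (if j = ⟨P.minLast, left_mem_Icc.2 P.minLast_le_maxLast⟩ then X 0 - 1 else 0) +
            (if j = ⟨P.maxLast, right_mem_Icc.2 P.minLast_le_maxLast⟩ then X 1 - 1 else 0)) := by
      intro b hb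
      rw [Set.Finite.mem_toFinset, mem_slice_bases j.2] at hb
      rw [Fin.prod_univ_castSucc]
      simp only [castSucc_mem_internallyActive j.2, castSucc_mem_externallyActive j.2,
        last_mem_internallyActive hb, last_mem_externallyActive hb, Fin.snoc_last, Subtype.ext_iff]
    rw [Finset.sum_congr rfl h, ← Finset.sum_mul, ← tutte_eq_sum_prod, mul_add, mul_add, mul_one,
      mul_ite, mul_ite, mul_zero, mul_comm _ (X 0 - 1), mul_comm _ (X 1 - 1)]
  rw [tutte_eq_sum_prod, sum_bases_eq_sum_slice, Finset.sum_congr rfl fun j _ => key j,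
    Finset.sum_add_distrib, Finset.sum_add_distrib]
  simp

/-- The exponent vector of the monomial `x ^ p * y ^ q`. -/
noncomputable abbrev bidegree (p q : ℕ) : Fin 2 →₀ ℕ := Finsupp.single 0 p + Finsupp.single 1 q

theorem coeff_bidegree_X_zero_mul (p q : ℕ) (T : MvPolynomial (Fin 2) ℤ) :
    coeff (bidegree p q) (X 0 * T) = if p = 0 then 0 else coeff (bidegree (p - 1) q) T := by
  rcases p with _ | p
  · simp [coeff_X_mul', Finsupp.mem_support_iff]
  · rw [show bidegree (p + 1) q = Finsupp.single 0 1 + bidegree p q by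
      rw [bidegree, bidegree, add_comm p, Finsupp.single_add, add_assoc], coeff_X_mul]
    simp

theorem coeff_bidegree_X_one_mul (p q : ℕ) (T : MvPolynomial (Fin 2) ℤ) :
    coeff (bidegree p q) (X 1 * T) = if q = 0 then 0 else coeff (bidegree p (q - 1)) T := by
  rcases q with _ | q
  · simp [coeff_X_mul', Finsupp.mem_support_iff]
  · rw [show bidegree p (q + 1) = Finsupp.single 1 1 + bidegree p q by
      rw [bidegree, bidegree, add_comm q, Finsupp.single_add, add_left_comm], coeff_X_mul]
    simp

theorem coeff_tutte_succ (P : Polymatroid (n + 1)) (p q : ℕ) :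
    coeff (bidegree p q) P.tutte =
      ∑ j ∈ (Icc P.minLast P.maxLast).attach,
        coeff (bidegree p q) (P.slice j (mem_Icc.1 j.2).2).tutte +
      ((if p = 0 then 0 else
        coeff (bidegree (p - 1) q) (P.slice P.minLast P.minLast_le_maxLast).tutte) -
        coeff (bidegree p q) (P.slice P.minLast P.minLast_le_maxLast).tutte) +
      ((if q = 0 then 0 else coeff (bidegree p (q - 1)) (P.slice P.maxLast le_rfl).tutte) -
        coeff (bidegree p q) (P.slice P.maxLast le_rfl).tutte) := by
  rw [tutte_eq_sum_slice, coeff_add, coeff_add, coeff_sum, sub_mul, sub_mul, one_mul, one_mul,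
    coeff_sub, coeff_sub, coeff_bidegree_X_zero_mul, coeff_bidegree_X_one_mul]

theorem coeff_tutte_eq_zero (P : Polymatroid n) (p q : ℕ) (h : n < p + q) :
    coeff (bidegree p q) P.tutte = 0 := by
  induction n generalizing p q with
  | zero =>
    rw [tutte_zero, coeff_one, if_neg]
    intro h0
    have h1 := DFunLike.congr_fun h0 0
    have h2 := DFunLike.congr_fun h0 1
    simp at h1 h2
    omega
  | succ n ih =>
    rw [coeff_tutte_succ, Finset.sum_eq_zero fun j _ => ih _ p q (by omega),
      ih _ p q (by omega), ih _ p q (by omega)]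
    split_ifs with hp hq hq
    · simp
    · rw [ih _ p (q - 1) (by omega)]; simp
    · rw [ih _ (p - 1) q (by omega)]; simp
    · rw [ih _ p (q - 1) (by omega), ih _ (p - 1) q (by omega)]; simp

/-- Only `x T_min` and `y T_max` reach this degree, and they add by Pascal's rule. -/
theorem coeff_tutte_top (P : Polymatroid n) (p q : ℕ) (h : p + q = n) :
    coeff (bidegree p q) P.tutte = n.choose q := by
  induction n generalizing p q with
  | zero =>
    obtain ⟨rfl, rfl⟩ : p = 0 ∧ q = 0 := by omega
    simp [tutte_zero, bidegree]
  | succ n ih =>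
    rw [coeff_tutte_succ, Finset.sum_eq_zero fun j _ => coeff_tutte_eq_zero _ p q (by omega),
      coeff_tutte_eq_zero _ p q (by omega), coeff_tutte_eq_zero _ p q (by omega)]
    rcases p with _ | p <;> rcases q with _ | q
    · omega
    · obtain rfl : q = n := by omega
      simp [ih _ 0 q (by omega)]
    · simp [ih _ p 0 (by omega)]
    · simp [ih _ p (q + 1) (by omega), ih _ (p + 1) q (by omega), Nat.choose_succ_succ]
      ring

theorem coeff_tutte_subtop (P : Polymatroid n) (p q : ℕ) (h : p + q + 1 = n) :
    coeff (bidegree p q) P.tutte =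
      ∑ S ∈ powersetCard q univ, P.rank S + ∑ S ∈ powersetCard (q + 1) univ, P.rank S -
        (n.choose q : ℤ) * P.rank univ - ((q : ℤ) + 1) * (n.choose (q + 1) : ℤ) := by
  induction n generalizing p q with
  | zero => omega
  | succ n ih =>
    have hcard : (#(Icc P.minLast P.maxLast) : ℤ) = P.maxLast + 1 - P.minLast := by
      have := P.minLast_le_maxLast
      rw [Int.card_Icc, Int.toNat_of_nonneg (by linarith)]
    -- For `p = 0`, so `q = n`, the closed form also vanishes: the first sum is the rank of the full
    -- set and the second is empty.
    have hmin : (if p = 0 then 0 else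
        coeff (bidegree (p - 1) q) (P.slice P.minLast P.minLast_le_maxLast).tutte) =
        ∑ S ∈ powersetCard q univ, P.rank (S.map Fin.castSuccEmb) +
          ∑ S ∈ powersetCard (q + 1) univ, P.rank (S.map Fin.castSuccEmb) -
          (n.choose q : ℤ) * P.rank (univ.map Fin.castSuccEmb) -
          ((q : ℤ) + 1) * (n.choose (q + 1) : ℤ) := by
      rcases p with _ | p
      · obtain rfl : q = n := by omega
        have h1 : powersetCard q (univ : Finset (Fin q)) = {univ} := by
          simpa using powersetCard_self (univ : Finset (Fin q))
        have h2 : powersetCard (q + 1) (univ : Finset (Fin q)) = ∅ :=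
          powersetCard_eq_empty.2 (by simp)
        simp [h1, h2]
      · simp only [Nat.add_eq_zero_iff, one_ne_zero, and_false, if_false, Nat.add_sub_cancel]
        rw [ih _ p q (by omega)]
        simp only [slice_minLast_rank]
    -- The differences of sums leave the sets containing the last index. For `q = 0` only its
    -- singleton remains, of rank `maxLast`, and everything cancels.
    have hmax : (if q = 0 then 0 else
        coeff (bidegree p (q - 1)) (P.slice P.maxLast le_rfl).tutte) =
        ∑ S ∈ powersetCard (q + 1) univ, P.rank S -
          ∑ S ∈ powersetCard (q + 1) univ, P.rank (S.map Fin.castSuccEmb) +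
        ∑ S ∈ powersetCard q univ, P.rank S -
          ∑ S ∈ powersetCard q univ, P.rank (S.map Fin.castSuccEmb)
          - ((n + 1).choose q : ℤ) * P.rank univ + (n.choose q : ℤ) * P.rank univ
          - (n.choose q : ℤ) * P.maxLast - (q : ℤ) * (n.choose q : ℤ) := by
      rw [sum_powersetCard_succ]
      rcases q with _ | q
      · simp [P.rank_empty, maxLast]
      · simp only [Nat.add_eq_zero_iff, one_ne_zero, and_false, if_false, Nat.add_sub_cancel]
        rw [ih _ p q (by omega), sum_powersetCard_succ, Nat.choose_succ_succ]
        simp only [slice_maxLast_rank, Finset.sum_sub_distrib, insert_last_map_univ,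
          sum_const, card_powersetCard, card_univ, Fintype.card_fin, nsmul_eq_mul]
        push_cast
        ring
    rw [coeff_tutte_succ, hmin, hmax,
      Finset.sum_congr rfl fun j _ => coeff_tutte_top _ p q (by omega), Finset.sum_const,
      card_attach, nsmul_eq_mul, hcard, coeff_tutte_top _ p q (by omega),
      coeff_tutte_top _ p q (by omega), Nat.choose_succ_succ n q, minLast]
    push_cast
    ring

end Tutte

end Polymatroid

theorem theorem5p3 (n : ℕ) (P : Polymatroid n) (k : ℕ) (hk1 : 1 ≤ k) (hkn : k ≤ n) :
    MvPolynomial.coeff (Finsupp.single 0 (n - k) + Finsupp.single 1 (k - 1)) P.tutte =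
      ∑ S ∈ powersetCard (k - 1) (univ : Finset (Fin n)), P.rank S +
        ∑ S ∈ powersetCard k (univ : Finset (Fin n)), P.rank S -
        (n.choose (k - 1) : ℤ) * P.rank univ - (k : ℤ) * (n.choose k : ℤ) := by
  obtain ⟨q, rfl⟩ := Nat.exists_eq_add_of_le' hk1
  rw [Nat.add_sub_cancel, Nat.cast_add, Nat.cast_one]
  exact P.coeff_tutte_subtop (n - (q + 1)) q (by omega)
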